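/- Let $\mathcal V$ be a finite vocabulary and let $\mathcal U$ be the infinite rooted tree in which every node has $|\mathcal V|$ children, one for each token. To every node $u$ attach a random probability vector $(\beta_{u,v})_{v\in\mathcal V}$ on $\mathcal V$ (so $\beta_{u,v}\ge 0$ and $\sum_{v}\beta_{u,v}=1$), where $\beta_{u,v}$ is the weight of the child $v$ of $u$; assume that these vectors are independent and identically distributed over the nodes $u$ (the coordinates of one vector may be dependent). The position $V(w)$ of a node $w$ is the sum of $-\log\beta_{u,v}\in[0,\infty]$ over the edges $(u,v)$ on the path from the root to $w$, with $-\log 0=\infty$; the root has position $0$. Let $$N(t)=\#\{w\in\mathcal U: V(w)\le t\},$$ and, writing $(\beta_v)_{v\in\mathcal V}$ for the vector at the root and using $0\log 0=0\log^2 0=0$, let $$\mu=\mathbb E\Big[-\sum_{v\in\mathcal V}\beta_v\log\beta_v\Big],\qquad \mu_{(2)}=\mathbb E\Big[\sum_{v\in\mathcal V}\beta_v\log^2\beta_v\Big].$$ The point process $\Xi_{\log}=\{-\log\beta_v : v\in\mathcal V,\ \beta_v>0\}$ is called arithmetic if there are $\lambda>0$ and $c_0\in\mathbb R$ such that almost surely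 $\Xi_{\log}\subseteq c_0+\lambda\mathbb Z$. Assume that $\mu>0$, that $\mu_{(2)}<\infty$, and that $\Xi_{\log}$ is not arithmetic. Then $\mathbb E[N(t)]<\infty$ for every $t\in\mathbb R$, and $$\mathbb E[N(t)]=\frac{e^t}{\mu}+o(e^t)\qquad\text{as } t\to\infty.$$ -/

import Mathlib

open MeasureTheory ProbabilityTheory Filter
open scoped ENNReal

noncomputable section

namespace TokenTree

/-! Nodes of the infinite `|V|`-ary token tree are finite token strings `u : List V`, written with
the most recent token first: the root is `[]`, the children of `u` are the nodes `v :: u`, and the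
depth of `u` is its length.  The weights are a family `β`, where `β u ω v` is the acceptance
probability of the child `v :: u` of `u` given that `u` is accepted. -/

variable {V Ω : Type*}

/-- The i.i.d. model: each node `u` carries a random probability vector `β u` on the vocabulary,
and these vectors are independent and identically distributed over the nodes.  The coordinates of
one vector may depend on each other in any way. -/
structure IsIID [Fintype V] [MeasurableSpace Ω] (P : Measure Ω) (β : List V → Ω → V → ℝ) :
    Prop where
  measurable : ∀ u, Measurable (β u)
  mem_simplex : ∀ u, ∀ᵐ ω ∂P, β u ω ∈ stdSimplex ℝ V
  indep : iIndepFun β P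
  identDistrib : ∀ u w, IdentDistrib (β u) (β w) P P

/-- The displacement `-log b` of a child of weight `b ∈ [0, 1]`, equal to `∞` if `b = 0`. -/
def displacement (b : ℝ) : ℝ≥0∞ :=
  if b = 0 then ⊤ else ENNReal.ofReal (-Real.log b)

/-- The position `V(u)` of the node `u` in the branching random walk: the sum of the displacements
along the path from the root to `u`. -/
def position (β : List V → Ω → V → ℝ) (ω : Ω) : List V → ℝ≥0∞
  | [] => 0
  | v :: u => position β ω u + displacement (β u ω v)

/-- `N(t)`, the number of nodes (of all generations, root included) at positions `≤ t`. -/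
def count (β : List V → Ω → V → ℝ) (t : ℝ) (ω : Ω) : ℕ∞ :=
  Set.encard {u : List V | (position β ω u : EReal) ≤ (t : EReal)}

/-- `E[N(t)]`, as an extended nonnegative number. -/
def expectedCount [MeasurableSpace Ω] (P : Measure Ω) (β : List V → Ω → V → ℝ) (t : ℝ) : ℝ≥0∞ :=
  ∫⁻ ω, (count β t ω : ℝ≥0∞) ∂P

/-- `μ = E[-∑ β_v log β_v]`, the expected entropy of the output distribution at the root. -/
def meanEntropy [Fintype V] [MeasurableSpace Ω] (P : Measure Ω) (β : List V → Ω → V → ℝ) : ℝ :=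
  ∫ ω, -∑ v, β [] ω v * Real.log (β [] ω v) ∂P

/-- `μ₍₂₎ = E[∑ β_v log² β_v]`, the expected second log-moment, possibly infinite. -/
def secondLogMoment [Fintype V] [MeasurableSpace Ω] (P : Measure Ω) (β : List V → Ω → V → ℝ) :
    ℝ≥0∞ :=
  ∫⁻ ω, ENNReal.ofReal (∑ v, β [] ω v * Real.log (β [] ω v) ^ 2) ∂P

/-- The set of points of the reproduction point process `Ξ_log = {-log β_v : v ∈ V}`; weights
`β_v = 0` contribute no point of the real line. -/
def reproduction (β : List V → Ω → V → ℝ) (ω : Ω) : Set ℝ :=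
  {x | ∃ v, 0 < β [] ω v ∧ x = -Real.log (β [] ω v)}

/-- A point process is arithmetic if, for some span `lam > 0` and some offset `c`, almost surely
all its points lie in the grid `c + lam ℤ`. -/
def IsArithmetic [MeasurableSpace Ω] (P : Measure Ω) (Xi : Ω → Set ℝ) : Prop :=
  ∃ lam : ℝ, 0 < lam ∧ ∃ c : ℝ, ∀ᵐ ω ∂P, Xi ω ⊆ {x | ∃ n : ℤ, x = c + lam * n}

end TokenTree

end

/-! Put M(t) = E[N(t)] and Z(t) = e^{-t} M(t). Cutting every non-root node off at its last edge,
whose weight is independent of the position of the parent, gives Z(t) = e^{-t} + ∫ Z(t - y) ρ(dy)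
for t ≥ 0. Here ρ = `tiltedLaw` is the law of the displacement to a child drawn with probability
β_v: a non-lattice probability measure on [0, ∞) with mean μ. So the claim is the renewal theorem Z
→ 1/μ, proved analytically in `tendsto_exp_neg_mul_of_renewal`.

Let W be the integral of Z from 0. Integrating the equation gives ∫ (W(t) - W(t - y)) ρ(dy) = 1 -
e^{-t} → 1, which also bounds Z, so W is Lipschitz. For a in the support of ρ, a maximum principle
shows that the increments of W at t and at t - a agree asymptotically. Such shifts a form a closed
subgroup, hence all of ℝ (`tendsto_increment_sub`). Increments of W are then asymptotically linear
in their length, and the integrated equation forces the slope 1/μ. Monotonicity of M carries the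
limit from W to Z.

Finiteness of M comes from the exponent 2: μ > 0 gives E[∑ β_v²] < 1, so a multiple of e^{2t}
dominates the counts truncated by depth (`weightedCount_depthLT_le`). -/

namespace TokenTree
-- Maximum principle for asymptotically ρ-harmonic functions
open scoped Topology

/-- Maximum principle: if an average of values asymptotically at most m tends to m, the values tend
to m in L¹(ρ). The Lipschitz bound turns this into convergence at each point of the support. -/
lemma tendsto_comp_sub_of_mem_support {ρ : Measure ℝ} [IsProbabilityMeasure ρ] {D : ℝ → ℝ}
    {L B m : ℝ} (hL : ∀ x y, |D x - D y| ≤ L * |x - y|) (hB : ∀ x, |D x| ≤ B)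
    (hD : Tendsto (fun t => D t - ∫ y, D (t - y) ∂ρ) atTop (𝓝 0))
    (hm : ∀ ε > 0, ∀ᶠ t in atTop, D t ≤ m + ε) {a : ℝ}
    (ha : ∀ δ > 0, 0 < ρ.real (Metric.ball a δ)) {s : ℕ → ℝ} (hs : Tendsto s atTop atTop)
    (hDs : Tendsto (fun n => D (s n)) atTop (𝓝 m)) :
    Tendsto (fun n => D (s n - a)) atTop (𝓝 m) := by
  have hL0 : 0 ≤ L := by simpa using (abs_nonneg _).trans (hL 1 0)
  have hc : Continuous D := (LipschitzWith.of_dist_le' hL).continuous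
  have hint (t : ℝ) : Integrable (fun y => D (t - y)) ρ :=
    Integrable.of_bound (by fun_prop) B (Eventually.of_forall fun y => hB _)
  have h1 : Tendsto (fun n => ∫ y, max (D (s n - y) - m) 0 ∂ρ) atTop (𝓝 0) := by
    have := tendsto_integral_of_dominated_convergence (μ := ρ)
      (F := fun n y => max (D (s n - y) - m) 0) (f := fun _ => 0) (fun _ => B + |m|)
      (fun n => by fun_prop) (integrable_const _)
      (fun n => Eventually.of_forall fun y => by
        have h1 := abs_le.1 (hB (s n - y))
        have h2 := neg_abs_le m
        rw [Real.norm_eq_abs, abs_of_nonneg (le_max_right _ _)]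
        exact max_le (by linarith) (by linarith [abs_nonneg m]))
      (Eventually.of_forall fun y => by
        rw [Metric.tendsto_nhds]
        intro ε hε
        have hsy : Tendsto (fun n => s n - y) atTop atTop :=
          tendsto_atTop_add_const_right _ (-y) hs
        filter_upwards [hsy.eventually (hm (ε / 2) (half_pos hε))] with n hn
        rw [Real.dist_eq, sub_zero, abs_of_nonneg (le_max_right _ _)]
        exact max_lt (by linarith) hε)
    simpa using this
  have h2 : Tendsto (fun n => ∫ y, |m - D (s n - y)| ∂ρ) atTop (𝓝 0) := by
    -- Uses |x| = x + 2x⁻ with x = m - D(s n - y); the mean of x is small by near-harmonicity, that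
    -- of x⁻ by `h1`.
    have e (n : ℕ) : ∫ y, |m - D (s n - y)| ∂ρ
        = m - D (s n) + (D (s n) - ∫ y, D (s n - y) ∂ρ)
          + 2 * ∫ y, max (D (s n - y) - m) 0 ∂ρ := by
      have e1 : ∀ y, |m - D (s n - y)| = (m - D (s n - y)) + 2 * max (D (s n - y) - m) 0 := by
        intro y
        rcases le_total (D (s n - y) - m) 0 with h | h
        · rw [max_eq_right h, abs_of_nonneg (by linarith)]; ring
        · rw [max_eq_left h, abs_of_nonpos (by linarith)]; ring
      have i1 : Integrable (fun y => m - D (s n - y)) ρ := (integrable_const _).sub (hint _)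
      have i2 : Integrable (fun y => 2 * max (D (s n - y) - m) 0) ρ :=
        (((hint _).sub (integrable_const _)).pos_part).const_mul 2
      simp_rw [e1]
      rw [integral_add i1 i2, integral_sub (integrable_const _) (hint _), integral_const_mul]
      simp
    simp_rw [e]
    have := ((hDs.const_sub m).add (hD.comp hs)).add (h1.const_mul 2)
    simpa using this
  rw [Metric.tendsto_nhds]
  intro ε hε
  set δ : ℝ := ε / (2 * (L + 1)) with hδ
  have hδ0 : 0 < δ := by positivity
  have hLδ : L * δ ≤ ε / 2 := by
    rw [hδ, mul_div_assoc', div_le_div_iff₀ (by positivity) (by positivity)]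
    nlinarith
  have hp := ha δ hδ0
  filter_upwards [h2.eventually_lt_const (show 0 < ρ.real (Metric.ball a δ) * (ε / 2) by positivity)]
    with n hn
  by_contra hcon
  rw [Real.dist_eq, not_lt] at hcon
  have iabs : Integrable (fun y => |m - D (s n - y)|) ρ :=
    ((integrable_const m).sub (hint (s n))).abs
  have h3 : ρ.real (Metric.ball a δ) * (ε / 2) ≤ ∫ y in Metric.ball a δ, |m - D (s n - y)| ∂ρ := by
    have : ∫ _ in Metric.ball a δ, (ε / 2) ∂ρ = ρ.real (Metric.ball a δ) * (ε / 2) := by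
      simp [Measure.real]
    rw [← this]
    refine setIntegral_mono_on (integrable_const _).integrableOn iabs.integrableOn
      measurableSet_ball fun y hy => ?_
    have h4 := hL (s n - a) (s n - y)
    have h5 : |s n - a - (s n - y)| ≤ δ := by
      rw [Metric.mem_ball, Real.dist_eq] at hy
      rw [show s n - a - (s n - y) = y - a by ring]
      exact hy.le
    have h6 : |D (s n - a) - m| ≤ |D (s n - a) - D (s n - y)| + |D (s n - y) - m| :=
      abs_sub_le _ _ _
    rw [abs_sub_comm (D (s n - y)) m] at h6
    nlinarith [mul_le_mul_of_nonneg_left h5 hL0]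
  have h7 := setIntegral_le_integral (s := Metric.ball a δ) iabs
    (Eventually.of_forall fun y => abs_nonneg _)
  linarith

/-- Along a sequence realising the limsup m, the maximum principle iterates: D is near m at s, s -
a, s - 2a, and so on. Summing K of these gives K m ≤ C for every K, so m ≤ 0. -/
lemma eventually_le_of_bounded_sums {ρ : Measure ℝ} [IsProbabilityMeasure ρ] {D : ℝ → ℝ}
    {L B C a : ℝ} (hL : ∀ x y, |D x - D y| ≤ L * |x - y|) (hB : ∀ x, |D x| ≤ B)
    (hD : Tendsto (fun t => D t - ∫ y, D (t - y) ∂ρ) atTop (𝓝 0))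
    (ha : ∀ δ > 0, 0 < ρ.real (Metric.ball a δ))
    (hC : ∀ (K : ℕ) t, ∑ k ∈ Finset.range K, D (t - k * a) ≤ C) :
    ∀ ε > 0, ∀ᶠ t in atTop, D t ≤ ε := by
  set m := limsup D atTop with hmdef
  have hbd : IsBoundedUnder (· ≤ ·) atTop D :=
    isBoundedUnder_of ⟨B, fun x => (abs_le.1 (hB x)).2⟩
  have hcb : IsCoboundedUnder (· ≤ ·) atTop D :=
    (isBoundedUnder_of (r := (· ≥ ·)) ⟨-B, fun x => (abs_le.1 (hB x)).1⟩).isCoboundedUnder_flip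
  have hm : ∀ ε > 0, ∀ᶠ t in atTop, D t ≤ m + ε := fun ε hε =>
    (eventually_lt_of_limsup_lt (show limsup D atTop < m + ε by linarith) hbd).mono
      fun t ht => ht.le
  have hfr : ∀ ε > 0, ∃ᶠ t in atTop, m - ε < D t := fun ε hε =>
    frequently_lt_of_lt_limsup hcb (by linarith)
  have hex : ∀ n : ℕ, ∃ t : ℝ, n ≤ t ∧ m - 1 / (n + 1) < D t ∧ D t ≤ m + 1 / (n + 1) := by
    intro n
    have hn : (0 : ℝ) < 1 / (n + 1) := by positivity
    obtain ⟨t, ht, h1, h2⟩ :=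
      ((hfr _ hn).and_eventually ((hm _ hn).and (eventually_ge_atTop (n : ℝ)))).exists
    exact ⟨t, h2, ht, h1⟩
  choose s hs1 hs2 hs3 using hex
  have hs : Tendsto s atTop atTop :=
    tendsto_atTop_mono hs1 tendsto_natCast_atTop_atTop
  have hDs : Tendsto (fun n => D (s n)) atTop (𝓝 m) := by
    have h0 : Tendsto (fun n : ℕ => 1 / ((n : ℝ) + 1)) atTop (𝓝 0) :=
      tendsto_one_div_add_atTop_nhds_zero_nat
    exact tendsto_of_tendsto_of_tendsto_of_le_of_le (by simpa using h0.const_sub m)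
      (by simpa using h0.const_add m) (fun n => (hs2 n).le) hs3
  have hk : ∀ k : ℕ, Tendsto (fun n => D (s n - k * a)) atTop (𝓝 m) := by
    intro k
    induction k with
    | zero => simpa using hDs
    | succ k ih =>
      have hsk : Tendsto (fun n => s n - k * a) atTop atTop :=
        tendsto_atTop_add_const_right _ (-(k * a)) hs
      refine (tendsto_comp_sub_of_mem_support hL hB hD hm ha hsk ih).congr fun n => ?_
      congr 1
      push_cast
      ring
  have hKm : ∀ K : ℕ, (K : ℝ) * m ≤ C := by
    intro K
    have := tendsto_finsetSum (Finset.range K) fun k _ => hk k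
    simp only [Finset.sum_const, Finset.card_range, nsmul_eq_mul] at this
    exact le_of_tendsto' this fun n => hC K (s n)
  have hm0 : m ≤ 0 := by
    by_contra! h
    obtain ⟨K, hK⟩ := exists_nat_gt (C / m)
    rw [div_lt_iff₀ h] at hK
    linarith [hKm K]
  intro ε hε
  filter_upwards [hm ε hε] with t ht
  linarith

lemma tendsto_zero_of_bounded_sums {ρ : Measure ℝ} [IsProbabilityMeasure ρ] {D : ℝ → ℝ}
    {L B C a : ℝ} (hL : ∀ x y, |D x - D y| ≤ L * |x - y|) (hB : ∀ x, |D x| ≤ B)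
    (hD : Tendsto (fun t => D t - ∫ y, D (t - y) ∂ρ) atTop (𝓝 0))
    (ha : ∀ δ > 0, 0 < ρ.real (Metric.ball a δ))
    (hC : ∀ (K : ℕ) t, |∑ k ∈ Finset.range K, D (t - k * a)| ≤ C) :
    Tendsto D atTop (𝓝 0) := by
  have h1 := eventually_le_of_bounded_sums hL hB hD ha fun K t => (abs_le.1 (hC K t)).2
  have h2 := eventually_le_of_bounded_sums (D := fun t => - D t) (L := L) (B := B) (C := C)
    (fun x y => by rw [neg_sub_neg, abs_sub_comm]; exact hL x y)
    (fun x => by rw [abs_neg]; exact hB x)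
    (by
      simp_rw [integral_neg]
      have := hD.neg
      rw [neg_zero] at this
      exact this.congr fun t => by ring)
    ha (fun K t => by rw [Finset.sum_neg_distrib]; linarith [(abs_le.1 (hC K t)).1])
  rw [Metric.tendsto_nhds]
  intro ε hε
  filter_upwards [h1 (ε / 2) (half_pos hε), h2 (ε / 2) (half_pos hε)] with t h3 h4
  rw [Real.dist_eq, sub_zero]
  exact abs_lt.2 ⟨by linarith, by linarith⟩

/-! ### Asymptotic linearity of increments -/

section Increments

variable {ρ : Measure ℝ} {W : ℝ → ℝ} {C : ℝ}

lemma integrable_increment (hint : Integrable (fun y => y) ρ)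
    (hW : ∀ x y, |W x - W y| ≤ C * |x - y|) (t : ℝ) :
    Integrable (fun y => W t - W (t - y)) ρ := by
  have hc : Continuous W := (LipschitzWith.of_dist_le' hW).continuous
  refine (hint.abs.const_mul C).mono' (by fun_prop) (Eventually.of_forall fun y => ?_)
  simpa using hW t (t - y)

/-- Let D be the mixed second difference of W with steps d and a. Then D - ρ * D is an alternating
sum of four translates of a convergent function, hence tends to 0, and sums of D along t - k a
telescope. -/
lemma tendsto_increment_sub_of_mem_support [IsProbabilityMeasure ρ] {l a : ℝ}
    (hint : Integrable (fun y => y) ρ) (hW : ∀ x y, |W x - W y| ≤ C * |x - y|)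
    (hR : Tendsto (fun t => ∫ y, (W t - W (t - y)) ∂ρ) atTop (𝓝 l))
    (ha : ∀ δ > 0, 0 < ρ.real (Metric.ball a δ)) (d : ℝ) :
    Tendsto (fun t => W t - W (t - d) - (W (t - a) - W (t - a - d))) atTop (𝓝 0) := by
  have hc : Continuous W := (LipschitzWith.of_dist_le' hW).continuous
  have hY (x : ℝ) : |W x - W (x - d)| ≤ C * |d| := by simpa using hW x (x - d)
  have hB (x : ℝ) : |W x - W (x - d) - (W (x - a) - W (x - a - d))| ≤ C * |d| + C * |d| :=
    (abs_sub _ _).trans (add_le_add (hY x) (hY (x - a)))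
  refine tendsto_zero_of_bounded_sums (ρ := ρ) (L := 4 * C) (C := C * |d| + C * |d|) (a := a)
    (fun x y => ?_) hB ?_ ha ?_
  · have h (c : ℝ) := abs_le.1 (hW (x - c) (y - c))
    simp only [sub_sub_sub_cancel_right] at h
    have h0 := h 0
    have h1 := h d
    have h2 := h a
    have h3 := h (a + d)
    simp only [sub_zero, ← sub_sub] at h0 h1 h2 h3
    rw [abs_le]
    constructor <;> linarith [h0.1, h0.2, h1.1, h1.2, h2.1, h2.2, h3.1, h3.2]
  · have hi := integrable_increment hint hW
    have hsh (c : ℝ) : Tendsto (fun t => ∫ y, (W (t - c) - W (t - c - y)) ∂ρ) atTop (𝓝 l) :=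
      hR.comp (tendsto_atTop_add_const_right _ (-c) tendsto_id)
    have hlim := (hR.sub (hsh d)).sub ((hsh a).sub (hsh (a + d)))
    rw [sub_self] at hlim
    refine hlim.congr fun t => ?_
    have hi2 (u v : ℝ) : Integrable (fun y => W u - W (u - y) - (W v - W (v - y))) ρ :=
      (hi u).sub (hi v)
    rw [← integral_sub (hi _) (hi _), ← integral_sub (hi _) (hi _),
      ← integral_sub (hi2 _ _) (hi2 _ _)]
    have hDi : Integrable (fun y => W (t - y) - W (t - y - d)
        - (W (t - y - a) - W (t - y - a - d))) ρ :=
      Integrable.of_bound (by fun_prop) _ (Eventually.of_forall fun y => hB _)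
    have hconst : W t - W (t - d) - (W (t - a) - W (t - a - d))
        = ∫ _, (W t - W (t - d) - (W (t - a) - W (t - a - d))) ∂ρ := by simp
    rw [hconst, ← integral_sub (integrable_const _) hDi]
    refine integral_congr_ae (Eventually.of_forall fun y => ?_)
    simp only [sub_right_comm t y, ← sub_sub]
    simp only [sub_right_comm _ y]
    ring
  · intro K t
    have hs : ∑ k ∈ Finset.range K, (W (t - k * a) - W (t - k * a - d)
        - (W (t - k * a - a) - W (t - k * a - a - d)))
        = (W t - W (t - d)) - (W (t - K * a) - W (t - K * a - d)) := by
      induction K with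
      | zero => simp
      | succ K ih =>
        rw [Finset.sum_range_succ, ih]
        push_cast
        rw [show t - (K + 1 : ℝ) * a = t - K * a - a by ring]
        ring
    rw [hs]
    exact (abs_sub _ _).trans (add_le_add (hY _) (hY _))

lemma tendsto_increment_sub [IsProbabilityMeasure ρ] {l : ℝ}
    (hint : Integrable (fun y => y) ρ) (hW : ∀ x y, |W x - W y| ≤ C * |x - y|)
    (hR : Tendsto (fun t => ∫ y, (W t - W (t - y)) ∂ρ) atTop (𝓝 l))
    (hna : ∀ c > (0 : ℝ), ¬ ∀ᵐ y ∂ρ, ∃ n : ℤ, y = c * n) (a d : ℝ) :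
    Tendsto (fun t => W t - W (t - d) - (W (t - a) - W (t - a - d))) atTop (𝓝 0) := by
  let H : AddSubgroup ℝ :=
    { carrier := {a | ∀ d, Tendsto (fun t => W t - W (t - d) - (W (t - a) - W (t - a - d)))
        atTop (𝓝 0)}
      zero_mem' := fun d => by simp
      add_mem' := fun {a b} ha hb d => by
        have h1 : Tendsto (fun t : ℝ => t - a) atTop atTop :=
          tendsto_atTop_add_const_right _ (-a) tendsto_id
        have := (ha d).add ((hb d).comp h1)
        rw [add_zero] at this
        refine this.congr fun t => ?_
        simp only [Function.comp_apply, ← sub_sub]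
        ring
      neg_mem' := fun {a} ha d => by
        have h1 : Tendsto (fun t : ℝ => t + a) atTop atTop :=
          tendsto_atTop_add_const_right _ a tendsto_id
        have := ((ha d).comp h1).neg
        rw [neg_zero] at this
        refine this.congr fun t => ?_
        simp only [Function.comp_apply, sub_neg_eq_add, add_sub_cancel_right]
        ring }
  -- Replacing a by a nearby b in `H` changes the second difference by at most 2C|a - b|, uniformly
  -- in t.
  have hclosed : closure (H : Set ℝ) ⊆ H := by
    have hC0 : 0 ≤ C := by simpa using (abs_nonneg _).trans (hW 1 0)
    intro a ha d
    rw [Metric.tendsto_nhds]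
    intro ε hε
    obtain ⟨b, hb, hab⟩ := Metric.mem_closure_iff.1 ha (ε / (4 * (C + 1))) (by positivity)
    filter_upwards [Metric.tendsto_nhds.1 (hb d) (ε / 2) (half_pos hε)] with t ht
    rw [Real.dist_eq, sub_zero] at ht ⊢
    rw [Real.dist_eq, lt_div_iff₀ (by positivity)] at hab
    have h1 := hW (t - a) (t - b)
    have h2 := hW (t - a - d) (t - b - d)
    rw [show t - a - (t - b) = -(a - b) by ring, abs_neg] at h1
    rw [show t - a - d - (t - b - d) = -(a - b) by ring, abs_neg] at h2
    rw [abs_le] at h1 h2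
    rw [abs_lt] at ht ⊢
    have := abs_nonneg (a - b)
    constructor <;> nlinarith
  have hsupp : ρ.support ⊆ H := fun a ha => by
    refine fun d => tendsto_increment_sub_of_mem_support hint hW hR (fun δ hδ => ?_) d
    exact ENNReal.toReal_pos
      (Measure.mem_support_iff_forall a |>.1 ha _ (Metric.ball_mem_nhds a hδ)).ne'
      (measure_ne_top _ _)
  rcases H.dense_or_cyclic with h | ⟨b, hb⟩
  · exact hclosed (h a) d
  · exfalso
    have hmem : ∀ᵐ y ∂ρ, ∃ n : ℤ, y = b * n := by
      filter_upwards [Measure.support_mem_ae (μ := ρ)] with y hy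
      have := hsupp hy
      rw [SetLike.mem_coe, hb, AddSubgroup.mem_closure_singleton] at this
      obtain ⟨n, hn⟩ := this
      exact ⟨n, by rw [← hn, zsmul_eq_mul, mul_comm]⟩
    rcases lt_trichotomy b 0 with h | h | h
    · refine hna (-b) (neg_pos.2 h) (hmem.mono fun y ⟨n, hn⟩ => ⟨-n, ?_⟩)
      push_cast
      linarith
    -- Here ρ is the point mass at 0, which lies in a lattice of any span.
    · exact hna 1 one_pos (hmem.mono fun y ⟨n, hn⟩ => ⟨0, by simp [hn, h]⟩)
    · exact hna b h hmem

/-- Average the d-increment over shifts in [0, 1] and the 1-increment over shifts in [0, d]. The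
averaged terms are the same symmetric double difference of a primitive of W, so they cancel. -/
lemma tendsto_increment_sub_mul [IsProbabilityMeasure ρ] {l : ℝ}
    (hint : Integrable (fun y => y) ρ) (hW : ∀ x y, |W x - W y| ≤ C * |x - y|)
    (hR : Tendsto (fun t => ∫ y, (W t - W (t - y)) ∂ρ) atTop (𝓝 l))
    (hna : ∀ c > (0 : ℝ), ¬ ∀ᵐ y ∂ρ, ∃ n : ℤ, y = c * n) (d : ℝ) :
    Tendsto (fun t => W t - W (t - d) - d * (W t - W (t - 1))) atTop (𝓝 0) := by
  have hc : Continuous W := (LipschitzWith.of_dist_le' hW).continuous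
  have havg (b e : ℝ) : Tendsto (fun t => ∫ x in (0 : ℝ)..b,
      (W t - W (t - e) - (W (t - x) - W (t - x - e)))) atTop (𝓝 0) := by
    have := intervalIntegral.tendsto_integral_filter_of_dominated_convergence
      (μ := volume) (a := 0) (b := b) (l := atTop)
      (F := fun t x => W t - W (t - e) - (W (t - x) - W (t - x - e))) (f := fun _ => 0)
      (fun _ => C * |e| + C * |e|)
      (Eventually.of_forall fun t => by fun_prop)
      (Eventually.of_forall fun t => Eventually.of_forall fun x _ => by
        have hY (x : ℝ) : |W x - W (x - e)| ≤ C * |e| := by simpa using hW x (x - e)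
        exact (abs_sub _ _).trans (add_le_add (hY _) (hY _)))
      (by simp)
      (Eventually.of_forall fun x _ => tendsto_increment_sub hint hW hR hna x e)
    simpa using this
  have h := (havg 1 d).sub (havg d 1)
  rw [sub_zero] at h
  refine h.congr fun t => ?_
  have hii (p q : ℝ) : IntervalIntegrable W volume p q := hc.intervalIntegrable _ _
  have e1 (b e : ℝ) : ∫ x in (0 : ℝ)..b, (W t - W (t - e) - (W (t - x) - W (t - x - e)))
      = b * (W t - W (t - e)) - ((∫ x in (t - b)..t, W x) - ∫ x in (t - e - b)..(t - e), W x) := by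
    have i1 : IntervalIntegrable (fun x => W (t - x)) volume 0 b :=
      (by fun_prop : Continuous fun x => W (t - x)).intervalIntegrable _ _
    have i2 : IntervalIntegrable (fun x => W (t - x - e)) volume 0 b :=
      (by fun_prop : Continuous fun x => W (t - x - e)).intervalIntegrable _ _
    rw [intervalIntegral.integral_sub (by simp) (i1.sub i2), intervalIntegral.integral_sub i1 i2]
    simp only [sub_right_comm t _ e]
    rw [intervalIntegral.integral_comp_sub_left W t, intervalIntegral.integral_comp_sub_left W (t - e)]
    simp only [intervalIntegral.integral_const, smul_eq_mul, sub_zero]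
  have e2 (p q : ℝ) : ∫ x in p..q, W x = (∫ x in (0 : ℝ)..q, W x) - ∫ x in (0 : ℝ)..p, W x :=
    (intervalIntegral.integral_interval_sub_left (hii _ _) (hii _ _)).symm
  rw [e1, e1, e2 (t - 1), e2 (t - d), e2 (t - d - 1), e2 (t - 1 - d), sub_right_comm t 1 d]
  ring

/-- Integrating the linearity W(t) - W(t - y) ≈ y (W(t) - W(t - 1)) against ρ, with dominating
function 2C|y|, identifies the slope as l divided by the mean. -/
lemma tendsto_increment [IsProbabilityMeasure ρ] {l : ℝ}
    (hint : Integrable (fun y => y) ρ) (hmean : 0 < ∫ y, y ∂ρ)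
    (hW : ∀ x y, |W x - W y| ≤ C * |x - y|)
    (hR : Tendsto (fun t => ∫ y, (W t - W (t - y)) ∂ρ) atTop (𝓝 l))
    (hna : ∀ c > (0 : ℝ), ¬ ∀ᵐ y ∂ρ, ∃ n : ℤ, y = c * n) (d : ℝ) :
    Tendsto (fun t => W t - W (t - d)) atTop (𝓝 (d * (l / ∫ y, y ∂ρ))) := by
  have hc : Continuous W := (LipschitzWith.of_dist_le' hW).continuous
  have hi := integrable_increment hint hW
  have h1 : Tendsto (fun t => ∫ y, (W t - W (t - y) - y * (W t - W (t - 1))) ∂ρ) atTop (𝓝 0) := by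
    have := tendsto_integral_filter_of_dominated_convergence (μ := ρ) (l := atTop)
      (F := fun t y => W t - W (t - y) - y * (W t - W (t - 1))) (f := fun _ => 0)
      (fun y => 2 * C * |y|)
      (Eventually.of_forall fun t => by fun_prop)
      (Eventually.of_forall fun t => Eventually.of_forall fun y => by
        have h2 : |W t - W (t - y)| ≤ C * |y| := by simpa using hW t (t - y)
        have h3 : |W t - W (t - 1)| ≤ C := by simpa using hW t (t - 1)
        refine (abs_sub _ _).trans ?_
        rw [abs_mul]
        nlinarith [mul_le_mul_of_nonneg_left h3 (abs_nonneg y)])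
      (hint.abs.const_mul _)
      (Eventually.of_forall fun y => tendsto_increment_sub_mul hint hW hR hna y)
    simpa using this
  have h2 : Tendsto (fun t => W t - W (t - 1)) atTop (𝓝 (l / ∫ y, y ∂ρ)) := by
    have h3 := (hR.sub h1).div_const (∫ y, y ∂ρ)
    rw [sub_zero] at h3
    refine h3.congr fun t => ?_
    rw [integral_sub (hi t) (hint.mul_const _), integral_mul_const]
    field_simp
    ring
  have h3 := (tendsto_increment_sub_mul hint hW hR hna d).add (h2.const_mul d)
  rw [zero_add] at h3
  exact h3.congr fun t => by ring

end Increments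

/-! ### Renewal equation and passage from W to Z -/

section Renewal

variable {ρ : Measure ℝ} {M : ℝ → ℝ}

lemma nonneg_of_monotone_of_neg (hmono : Monotone M) (hneg : ∀ t < 0, M t = 0) (t : ℝ) :
    0 ≤ M t := by
  rw [← hneg (min t (-1)) (min_lt_of_right_lt (by norm_num))]
  exact hmono (min_le_left _ _)

lemma exp_neg_mul_nonneg (hmono : Monotone M) (hneg : ∀ t < 0, M t = 0) (t : ℝ) :
    0 ≤ Real.exp (-t) * M t :=
  mul_nonneg (Real.exp_pos _).le (nonneg_of_monotone_of_neg hmono hneg t)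

lemma exp_neg_mul_le (hmono : Monotone M) (hneg : ∀ t < 0, M t = 0) {x t : ℝ} (hxt : x ≤ t) :
    Real.exp (-x) * M x ≤ M t := by
  rcases lt_or_ge x 0 with h | h
  · rw [hneg x h, mul_zero]
    exact nonneg_of_monotone_of_neg hmono hneg t
  · calc Real.exp (-x) * M x ≤ 1 * M x :=
          mul_le_mul_of_nonneg_right (Real.exp_le_one_iff.2 (by linarith))
            (nonneg_of_monotone_of_neg hmono hneg x)
      _ ≤ M t := by rw [one_mul]; exact hmono hxt

lemma intervalIntegrable_exp_neg_mul (hmono : Monotone M) (p q : ℝ) :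
    IntervalIntegrable (fun x => Real.exp (-x) * M x) volume p q :=
  hmono.intervalIntegrable.continuousOn_mul (by fun_prop)

lemma exp_neg_mul_sub_le (hmono : Monotone M) {x t : ℝ} (hxt : x ≤ t) :
    Real.exp (-(t - x)) * (Real.exp (-x) * M x) ≤ Real.exp (-t) * M t := by
  rw [← mul_assoc, ← Real.exp_add, show -(t - x) + -x = -t by ring]
  exact mul_le_mul_of_nonneg_left (hmono hxt) (Real.exp_pos _).le

/-- The integral over `[0, t]` of the discounted function `x ↦ e^{-x} M(x)`. -/
noncomputable def discountedIntegral (M : ℝ → ℝ) (t : ℝ) : ℝ :=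
  ∫ x in (0 : ℝ)..t, Real.exp (-x) * M x

lemma discountedIntegral_sub (hmono : Monotone M) (p q : ℝ) :
    discountedIntegral M q - discountedIntegral M p = ∫ x in p..q, Real.exp (-x) * M x :=
  intervalIntegral.integral_interval_sub_left (intervalIntegrable_exp_neg_mul hmono _ _)
    (intervalIntegrable_exp_neg_mul hmono _ _)

lemma monotone_discountedIntegral (hmono : Monotone M) (hneg : ∀ t < 0, M t = 0) :
    Monotone (discountedIntegral M) := fun p q hpq => by
  rw [← sub_nonneg, discountedIntegral_sub hmono]
  exact intervalIntegral.integral_nonneg hpq fun x _ => exp_neg_mul_nonneg hmono hneg x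

lemma discountedIntegral_of_nonpos (hneg : ∀ t < 0, M t = 0) {t : ℝ} (ht : t ≤ 0) :
    discountedIntegral M t = 0 := by
  rw [discountedIntegral, intervalIntegral.integral_symm, neg_eq_zero,
    intervalIntegral.integral_of_le ht, integral_Ioc_eq_integral_Ioo]
  exact setIntegral_eq_zero_of_forall_eq_zero fun x hx => by rw [hneg x hx.2, mul_zero]

lemma le_discountedIntegral_sub (hmono : Monotone M) (hneg : ∀ t < 0, M t = 0) {t p q c : ℝ}
    (hp : t ≤ p) (hpq : p ≤ q) (hq : q ≤ t + c) :
    (q - p) * (Real.exp (-c) * (Real.exp (-t) * M t))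
      ≤ discountedIntegral M q - discountedIntegral M p := by
  rw [discountedIntegral_sub hmono, ← smul_eq_mul, ← intervalIntegral.integral_const]
  refine intervalIntegral.integral_mono_on hpq (by simp)
    (intervalIntegrable_exp_neg_mul hmono _ _) fun x hx => ?_
  refine le_trans ?_ (exp_neg_mul_sub_le hmono (hp.trans hx.1))
  exact mul_le_mul_of_nonneg_right (Real.exp_le_exp.2 (by linarith [hx.2]))
    (exp_neg_mul_nonneg hmono hneg t)

lemma discountedIntegral_sub_le (hmono : Monotone M) (hneg : ∀ t < 0, M t = 0) {t d : ℝ}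
    (hd : 0 ≤ d) :
    discountedIntegral M t - discountedIntegral M (t - d)
      ≤ d * (Real.exp d * (Real.exp (-t) * M t)) := by
  have h : d * (Real.exp d * (Real.exp (-t) * M t))
      = ∫ _ in (t - d)..t, Real.exp d * (Real.exp (-t) * M t) := by
    rw [intervalIntegral.integral_const, sub_sub_cancel, smul_eq_mul]
  rw [discountedIntegral_sub hmono, h]
  refine intervalIntegral.integral_mono_on (by linarith)
    (intervalIntegrable_exp_neg_mul hmono _ _) (by simp) fun x hx => ?_
  have h1 := exp_neg_mul_sub_le hmono hx.2
  rw [Real.exp_neg (t - x), inv_mul_le_iff₀ (Real.exp_pos _)] at h1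
  refine h1.trans ?_
  exact mul_le_mul_of_nonneg_right (Real.exp_le_exp.2 (by linarith [hx.1]))
    (exp_neg_mul_nonneg hmono hneg t)

variable [IsProbabilityMeasure ρ]

/-- Integrate the renewal equation over [0, t] and apply Fubini; the source e^{-s} contributes 1 -
e^{-t}. -/
lemma discountedIntegral_renewal (hmono : Monotone M) (hneg : ∀ t < 0, M t = 0)
    (hpos : ∀ᵐ y ∂ρ, 0 ≤ y)
    (hren : ∀ t ≥ 0, Real.exp (-t) * M t
      = Real.exp (-t) + ∫ y, Real.exp (-(t - y)) * M (t - y) ∂ρ) {t : ℝ} (ht : 0 ≤ t) :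
    ∫ y, (discountedIntegral M t - discountedIntegral M (t - y)) ∂ρ = 1 - Real.exp (-t) := by
  have hWm := monotone_discountedIntegral hmono hneg
  have hMm : Measurable M := hmono.measurable
  have hWi : Integrable (fun y => discountedIntegral M (t - y)) ρ := by
    have hm : Measurable (discountedIntegral M) := hWm.measurable
    refine Integrable.of_bound (hm.comp (measurable_const_sub t)).aestronglyMeasurable
      (discountedIntegral M t) ?_
    filter_upwards [hpos] with y hy
    have h0 : 0 ≤ discountedIntegral M (t - y) := by
      rcases le_total 0 (t - y) with h | h
      · rw [← discountedIntegral_of_nonpos hneg le_rfl]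
        exact hWm h
      · rw [discountedIntegral_of_nonpos hneg h]
    rw [Real.norm_eq_abs, abs_of_nonneg h0]
    exact hWm (by linarith)
  have hprod : Integrable (Function.uncurry fun s y => Real.exp (-(s - y)) * M (s - y))
      ((volume.restrict (Set.Ioc 0 t)).prod ρ) := by
    refine Integrable.of_bound (C := M t) ?_ ?_
    · refine Measurable.aestronglyMeasurable ?_
      unfold Function.uncurry
      fun_prop
    · have hs : ∀ᵐ z ∂((volume.restrict (Set.Ioc 0 t)).prod ρ), z.1 ∈ Set.Ioc 0 t :=
        Measure.quasiMeasurePreserving_fst.ae (ae_restrict_mem measurableSet_Ioc)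
      have hy : ∀ᵐ z ∂((volume.restrict (Set.Ioc 0 t)).prod ρ), 0 ≤ z.2 :=
        Measure.quasiMeasurePreserving_snd.ae hpos
      filter_upwards [hs, hy] with z hz1 hz2
      simp only [Function.uncurry]
      rw [Real.norm_eq_abs, abs_of_nonneg (exp_neg_mul_nonneg hmono hneg _)]
      exact exp_neg_mul_le hmono hneg (by linarith [hz1.2])
  have hswap : ∫ s in (0 : ℝ)..t, ∫ y, Real.exp (-(s - y)) * M (s - y) ∂ρ
      = ∫ y, discountedIntegral M (t - y) ∂ρ := by
    rw [intervalIntegral.integral_of_le ht, integral_integral_swap hprod]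
    refine integral_congr_ae ?_
    filter_upwards [hpos] with y hy
    rw [← intervalIntegral.integral_of_le ht,
      intervalIntegral.integral_comp_sub_right (fun x => Real.exp (-x) * M x) y,
      ← discountedIntegral_sub hmono, discountedIntegral_of_nonpos hneg (by linarith : 0 - y ≤ 0),
      sub_zero]
  have hinner : IntervalIntegrable (fun s => ∫ y, Real.exp (-(s - y)) * M (s - y) ∂ρ) volume 0 t := by
    rw [intervalIntegrable_iff_integrableOn_Ioc_of_le ht]
    exact hprod.integral_prod_left
  have hW : discountedIntegral M t
      = (1 - Real.exp (-t)) + ∫ y, discountedIntegral M (t - y) ∂ρ := by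
    rw [← hswap]
    calc discountedIntegral M t
        = ∫ s in (0 : ℝ)..t, (Real.exp (-s) + ∫ y, Real.exp (-(s - y)) * M (s - y) ∂ρ) :=
          intervalIntegral.integral_congr fun s hs => hren s (by
            rw [Set.uIcc_of_le ht] at hs
            exact hs.1)
      _ = _ := by
          rw [intervalIntegral.integral_add
            ((by fun_prop : Continuous fun s => Real.exp (-s)).intervalIntegrable _ _) hinner,
            intervalIntegral.integral_comp_neg (fun x => Real.exp x), integral_exp]
          simp
  rw [integral_sub (integrable_const _) hWi]
  simp only [integral_const, probReal_univ, one_smul]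
  linarith

/-- Since M is monotone, Z ≥ e^{-1} Z(t) on [t, t + 1]. The integrated equation at t + 1 therefore
gives e^{-1} Z(t) ∫ min(y, 1) ρ(dy) ≤ 1. -/
lemma exists_exp_neg_mul_le (hmono : Monotone M) (hneg : ∀ t < 0, M t = 0)
    (hpos : ∀ᵐ y ∂ρ, 0 ≤ y) (hint : Integrable (fun y => y) ρ) (hmean : 0 < ∫ y, y ∂ρ)
    (hren : ∀ t ≥ 0, Real.exp (-t) * M t
      = Real.exp (-t) + ∫ y, Real.exp (-(t - y)) * M (t - y) ∂ρ) :
    ∃ C, ∀ t, Real.exp (-t) * M t ≤ C := by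
  have hWm := monotone_discountedIntegral hmono hneg
  have himin : Integrable (fun y => min y 1) ρ := hint.inf (integrable_const 1)
  have hκ : 0 < ∫ y, min y 1 ∂ρ := by
    rw [integral_pos_iff_support_of_nonneg_ae (hpos.mono fun y hy => le_min hy zero_le_one) himin]
    rw [integral_pos_iff_support_of_nonneg_ae hpos hint] at hmean
    refine hmean.trans_le (measure_mono fun y hy => ?_)
    simp only [Function.mem_support] at hy ⊢
    rcases min_choice y 1 with h | h <;> rw [h]
    · exact hy
    · exact one_ne_zero
  refine ⟨Real.exp 1 / ∫ y, min y 1 ∂ρ, fun t => ?_⟩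
  rcases lt_or_ge t 0 with ht | ht
  · rw [hneg t ht, mul_zero]
    positivity
  · have h1 := discountedIntegral_renewal hmono hneg hpos hren (t := t + 1) (by linarith)
    have hi : Integrable (fun y => discountedIntegral M (t + 1)
        - discountedIntegral M (t + 1 - y)) ρ := by
      -- A non-integrable function has integral 0 by convention, but this integral equals 1 -
      -- e^{-(t+1)} > 0.
      by_contra hcon
      rw [integral_undef hcon] at h1
      have : Real.exp (-(t + 1)) < 1 := by
        rw [Real.exp_lt_one_iff]
        linarith
      linarith
    have h2 : ∫ y, min y 1 * (Real.exp (-1) * (Real.exp (-t) * M t)) ∂ρ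
        ≤ ∫ y, (discountedIntegral M (t + 1) - discountedIntegral M (t + 1 - y)) ∂ρ := by
      refine integral_mono_ae (himin.mul_const _) hi ?_
      filter_upwards [hpos] with y hy
      have h3 := le_discountedIntegral_sub hmono hneg (t := t) (p := t + 1 - min y 1) (q := t + 1)
        (c := 1) (by linarith [min_le_right y 1]) (by linarith [le_min hy zero_le_one]) le_rfl
      rw [sub_sub_cancel] at h3
      have h4 : discountedIntegral M (t + 1 - y) ≤ discountedIntegral M (t + 1 - min y 1) :=
        hWm (by linarith [min_le_left y 1])
      exact h3.trans (by linarith)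
    rw [integral_mul_const, h1] at h2
    have h5 := Real.exp_pos (-(t + 1))
    rw [le_div_iff₀ hκ]
    rw [Real.exp_neg 1] at h2
    have h6 := Real.exp_pos 1
    have h7 : (∫ y, min y 1 ∂ρ) * (Real.exp (-t) * M t) / Real.exp 1 ≤ 1 := by
      rw [div_eq_mul_inv]
      linarith
    rw [div_le_one h6] at h7
    linarith

/-- Key renewal theorem for a nonlattice law on the half-line, for the exponentially growing
solution of the renewal equation with source `1_{t ≥ 0}`. -/
theorem tendsto_exp_neg_mul_of_renewal (hmono : Monotone M) (hneg : ∀ t < 0, M t = 0)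
    (hpos : ∀ᵐ y ∂ρ, 0 ≤ y) (hint : Integrable (fun y => y) ρ) (hmean : 0 < ∫ y, y ∂ρ)
    (hna : ∀ c > (0 : ℝ), ¬ ∀ᵐ y ∂ρ, ∃ n : ℤ, y = c * n)
    (hren : ∀ t ≥ 0, Real.exp (-t) * M t
      = Real.exp (-t) + ∫ y, Real.exp (-(t - y)) * M (t - y) ∂ρ) :
    Tendsto (fun t => Real.exp (-t) * M t) atTop (𝓝 (1 / ∫ y, y ∂ρ)) := by
  obtain ⟨C, hC⟩ := exists_exp_neg_mul_le hmono hneg hpos hint hmean hren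
  have hLip (x y : ℝ) : |discountedIntegral M x - discountedIntegral M y| ≤ C * |x - y| := by
    rw [discountedIntegral_sub hmono, ← Real.norm_eq_abs]
    refine intervalIntegral.norm_integral_le_of_norm_le_const fun z _ => ?_
    rw [Real.norm_eq_abs, abs_of_nonneg (exp_neg_mul_nonneg hmono hneg z)]
    exact hC z
  have hR : Tendsto (fun t => ∫ y, (discountedIntegral M t - discountedIntegral M (t - y)) ∂ρ)
      atTop (𝓝 1) := by
    have h : Tendsto (fun t : ℝ => 1 - Real.exp (-t)) atTop (𝓝 (1 - 0)) :=
      Real.tendsto_exp_neg_atTop_nhds_zero.const_sub 1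
    rw [sub_zero] at h
    refine h.congr' ?_
    filter_upwards [eventually_ge_atTop 0] with t ht
    exact (discountedIntegral_renewal hmono hneg hpos hren ht).symm
  have hinc (d : ℝ) := tendsto_increment hint hmean hLip hR hna d
  set c := 1 / ∫ y, y ∂ρ with hc
  -- Monotonicity of M gives W(t) - W(t - d) ≤ d e^d Z(t) and W(t + d) - W(t) ≥ d e^{-d} Z(t). Let t
  -- → ∞ with d fixed but small.
  rw [tendsto_order]
  constructor
  · intro b hb
    have h1 : Tendsto (fun d : ℝ => Real.exp (-d) * c) (𝓝[>] 0) (𝓝 c) := by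
      have : Continuous fun d : ℝ => Real.exp (-d) * c := by fun_prop
      have := this.tendsto 0
      simp only [neg_zero, Real.exp_zero, one_mul] at this
      exact this.mono_left nhdsWithin_le_nhds
    obtain ⟨d, hd1, hd0⟩ := ((h1.eventually_const_lt hb).and self_mem_nhdsWithin).exists
    have h2 := ((hinc d).div_const d).const_mul (Real.exp (-d))
    rw [mul_div_cancel_left₀ _ hd0.ne'] at h2
    filter_upwards [h2.eventually_const_lt hd1] with t ht
    refine ht.trans_le ?_
    rw [Real.exp_neg, inv_mul_le_iff₀ (Real.exp_pos _), div_le_iff₀ hd0]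
    linarith [discountedIntegral_sub_le hmono hneg (t := t) hd0.le]
  · intro b hb
    have h1 : Tendsto (fun d : ℝ => Real.exp d * c) (𝓝[>] 0) (𝓝 c) := by
      have : Continuous fun d : ℝ => Real.exp d * c := by fun_prop
      have := this.tendsto 0
      simp only [Real.exp_zero, one_mul] at this
      exact this.mono_left nhdsWithin_le_nhds
    obtain ⟨d, hd1, hd0⟩ := ((h1.eventually_lt_const hb).and self_mem_nhdsWithin).exists
    have h3 : Tendsto (fun t => discountedIntegral M (t + d) - discountedIntegral M t) atTop
        (𝓝 (d * c)) :=
      ((hinc d).comp (tendsto_atTop_add_const_right _ d tendsto_id)).congr fun t => by simp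
    have h2 := (h3.div_const d).const_mul (Real.exp d)
    rw [mul_div_cancel_left₀ _ hd0.ne'] at h2
    filter_upwards [h2.eventually_lt_const hd1] with t ht
    refine lt_of_le_of_lt ?_ ht
    have h4 := le_discountedIntegral_sub hmono hneg (t := t) (p := t) (q := t + d) (c := d) le_rfl
      (by linarith) le_rfl
    rw [add_sub_cancel_left, Real.exp_neg d] at h4
    rw [← inv_mul_le_iff₀ (Real.exp_pos _), le_div_iff₀ hd0]
    linarith

end Renewal

/-! ### Positions and the last-edge decomposition -/

lemma coe_le_coe_iff_le_ofReal (x : ℝ≥0∞) (t : ℝ) :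
    (x : EReal) ≤ (t : EReal) ↔ 0 ≤ t ∧ x ≤ ENNReal.ofReal t := by
  constructor
  · intro h
    have ht : 0 ≤ t := by exact_mod_cast (EReal.coe_ennreal_nonneg x).trans h
    refine ⟨ht, ?_⟩
    rwa [← EReal.coe_ennreal_le_coe_ennreal_iff, EReal.coe_ennreal_ofReal, max_eq_left ht]
  · rintro ⟨ht, h⟩
    rwa [← EReal.coe_ennreal_le_coe_ennreal_iff, EReal.coe_ennreal_ofReal, max_eq_left ht] at h

lemma measurable_displacement : Measurable displacement :=
  Measurable.ite (measurableSet_singleton 0) measurable_const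
    (Real.measurable_log.neg.ennreal_ofReal)

lemma add_displacement_le_iff {b : ℝ} (h0 : 0 ≤ b) (h1 : b ≤ 1) (x : ℝ≥0∞) (t : ℝ) :
    ((x + displacement b : ℝ≥0∞) : EReal) ≤ (t : EReal) ↔
      0 < b ∧ (x : EReal) ≤ ((t + Real.log b : ℝ) : EReal) := by
  rcases h0.eq_or_lt with rfl | hb
  · simp [displacement]
  · have hl : 0 ≤ -Real.log b := neg_nonneg.2 (Real.log_nonpos h0 h1)
    simp only [hb, true_and, displacement, hb.ne', if_false]
    rw [coe_le_coe_iff_le_ofReal, coe_le_coe_iff_le_ofReal]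
    induction x with
    | top => simp
    | coe x =>
      rw [← ENNReal.ofReal_coe_nnreal, ← ENNReal.ofReal_add x.coe_nonneg hl]
      constructor
      · rintro ⟨ht, h⟩
        rw [ENNReal.ofReal_le_ofReal_iff ht] at h
        -- `ENNReal.ofReal` truncates negative numbers to 0, so the sign of the new threshold must
        -- be known.
        have h3 : 0 ≤ t + Real.log b := by linarith [x.coe_nonneg]
        exact ⟨h3, (ENNReal.ofReal_le_ofReal_iff h3).2 (by linarith)⟩
      · rintro ⟨ht, h⟩
        rw [ENNReal.ofReal_le_ofReal_iff ht] at h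
        have h3 : 0 ≤ t := by linarith
        exact ⟨h3, (ENNReal.ofReal_le_ofReal_iff h3).2 (by linarith)⟩

section Model

variable {V Ω : Type*}

lemma measurable_position {m : MeasurableSpace Ω} {β : List V → Ω → V → ℝ} {w : List V}
    (h : ∀ u : List V, u.length < w.length → Measurable (β u)) :
    Measurable fun ω => position β ω w := by
  induction w with
  | nil => exact measurable_const
  | cons v u ih =>
    refine (ih fun u' hu' => h u' (hu'.trans (by simp))).add ?_
    exact measurable_displacement.comp ((measurable_pi_apply v).comp (h u (by simp)))

variable [MeasurableSpace Ω] {P : Measure Ω} {β : List V → Ω → V → ℝ}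

/-- The distribution function of the position of the node `w`. -/
noncomputable def positionCdf (P : Measure Ω) (β : List V → Ω → V → ℝ) (w : List V) (t : ℝ) :
    ℝ≥0∞ :=
  P {ω | (position β ω w : EReal) ≤ (t : EReal)}

lemma monotone_positionCdf (w : List V) : Monotone (positionCdf P β w) := fun _ _ hst =>
  measure_mono (Set.ofPred_subset_ofPred.2 fun _ hω => le_trans hω (EReal.coe_le_coe_iff.2 hst))

lemma measurableSet_coe_le (t : ℝ) : MeasurableSet {x : ℝ≥0∞ | (x : EReal) ≤ (t : EReal)} :=
  measurableSet_le measurable_coe_ennreal_ereal measurable_const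

lemma positionCdf_of_neg (w : List V) {t : ℝ} (ht : t < 0) : positionCdf P β w t = 0 := by
  simp [positionCdf, coe_le_coe_iff_le_ofReal, ht.not_ge]

lemma positionCdf_nil [IsProbabilityMeasure P] {t : ℝ} (ht : 0 ≤ t) :
    positionCdf P β [] t = 1 := by
  simp [positionCdf, ht, position]

/-- The expected number of nodes at positions `≤ t`, each node `w` being counted `c w` times. -/
noncomputable def weightedCount (P : Measure Ω) (β : List V → Ω → V → ℝ) (c : List V → ℝ≥0∞)
    (t : ℝ) : ℝ≥0∞ :=
  ∑' w, c w * positionCdf P β w t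

lemma monotone_weightedCount (c : List V → ℝ≥0∞) : Monotone (weightedCount P β c) :=
  fun _ _ hst => ENNReal.tsum_le_tsum fun w => mul_le_mul_right (monotone_positionCdf w hst) _

lemma weightedCount_of_neg (c : List V → ℝ≥0∞) {t : ℝ} (ht : t < 0) :
    weightedCount P β c t = 0 := by
  simp [weightedCount, positionCdf_of_neg _ ht]

variable [Fintype V]

/-- The position of w uses only the vectors at its proper ancestors, all shorter than w. -/
lemma IsIID.indepFun_position (hiid : IsIID P β) (w : List V) :
    IndepFun (fun ω => position β ω w) (β w) P := by
  have h1 := indep_iSup_of_disjoint (μ := P)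
    (m := fun u : List V => MeasurableSpace.comap (β u) inferInstance)
    (fun u => (hiid.measurable u).comap_le) hiid.indep
    (S := {u | u.length < w.length}) (T := {w}) (by simp)
  rw [IndepFun_iff_Indep]
  refine indep_of_indep_of_le_left (indep_of_indep_of_le_right h1 (by simp)) ?_
  rw [← measurable_iff_comap_le]
  refine measurable_position fun u hu => ?_
  rw [measurable_iff_comap_le]
  exact le_iSup₂ (f := fun (u : List V) (_ : u ∈ {u : List V | u.length < w.length}) =>
    MeasurableSpace.comap (β u) inferInstance) u hu

/-- Condition on the last edge; `β u` may be replaced by the root vector because only its law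
enters. No self-similarity of subtrees is needed. -/
lemma IsIID.positionCdf_cons [IsProbabilityMeasure P] (hiid : IsIID P β) (v : V) (u : List V)
    (t : ℝ) :
    positionCdf P β (v :: u) t = ∫⁻ ω,
      if 0 < β [] ω v then positionCdf P β u (t + Real.log (β [] ω v)) else 0 ∂P := by
  have hX : Measurable fun ω => position β ω u :=
    measurable_position fun u' _ => hiid.measurable u'
  have hY := hiid.measurable u
  have hA : MeasurableSet {z : ℝ≥0∞ × (V → ℝ) |
      ((z.1 + displacement (z.2 v) : ℝ≥0∞) : EReal) ≤ (t : EReal)} := by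
    refine measurableSet_coe_le t |>.preimage (f := fun z : ℝ≥0∞ × (V → ℝ) =>
      z.1 + displacement (z.2 v)) ?_
    exact measurable_fst.add
      (measurable_displacement.comp ((measurable_pi_apply v).comp measurable_snd))
  have hind := (indepFun_iff_map_prod_eq_prod_map_map hX.aemeasurable hY.aemeasurable).1
    (hiid.indepFun_position u)
  have : IsProbabilityMeasure (P.map fun ω => position β ω u) :=
    Measure.isProbabilityMeasure_map hX.aemeasurable
  have : IsProbabilityMeasure (P.map (β u)) := Measure.isProbabilityMeasure_map hY.aemeasurable
  have e1 : positionCdf P β (v :: u) t = P.map (fun ω => (position β ω u, β u ω))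
      {z : ℝ≥0∞ × (V → ℝ) | ((z.1 + displacement (z.2 v) : ℝ≥0∞) : EReal) ≤ (t : EReal)} := by
    rw [Measure.map_apply (hX.prodMk hY) hA]
    rfl
  rw [e1, hind, Measure.prod_apply_symm hA, (hiid.identDistrib u []).map_eq,
    lintegral_map (measurable_measure_prodMk_right hA) (hiid.measurable [])]
  refine lintegral_congr_ae ?_
  filter_upwards [hiid.mem_simplex []] with ω hω
  have h1 : β [] ω v ≤ 1 := by
    rw [← hω.2]
    exact Finset.single_le_sum (fun i _ => hω.1 i) (Finset.mem_univ v)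
  simp only [Set.preimage_ofPred_eq, add_displacement_le_iff (hω.1 v) h1]
  split_ifs with hb
  · simp only [hb, true_and]
    rw [Measure.map_apply hX (measurableSet_coe_le _)]
    rfl
  · simp [hb]

lemma tsum_list (f : List V → ℝ≥0∞) : ∑' w, f w = f [] + ∑ v, ∑' u, f (v :: u) := by
  classical
  rw [ENNReal.tsum_eq_add_tsum_ite [], ← tsum_fintype (L := .unconditional V), ← ENNReal.tsum_prod]
  congr 1
  have hinj : Function.Injective fun p : V × List V => p.1 :: p.2 := fun p q h => by
    simpa [Prod.ext_iff] using h
  rw [← hinj.tsum_eq]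
  · simp
  · intro w hw
    cases w with
    | nil => simp at hw
    | cons v u => exact ⟨(v, u), rfl⟩

/-- Two weights c and c' cover both the full count (both 1) and the depth truncation, where removing
an edge lowers the depth bound. -/
lemma IsIID.weightedCount_eq [IsProbabilityMeasure P] (hiid : IsIID P β) (c c' : List V → ℝ≥0∞)
    (hc : ∀ v u, c (v :: u) = c' u) {t : ℝ} (ht : 0 ≤ t) :
    weightedCount P β c t = c [] + ∑ v, ∫⁻ ω,
      if 0 < β [] ω v then weightedCount P β c' (t + Real.log (β [] ω v)) else 0 ∂P := by
  rw [weightedCount, tsum_list, positionCdf_nil ht, mul_one]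
  congr 1
  refine Finset.sum_congr rfl fun v _ => ?_
  have hb : Measurable fun ω => β [] ω v := (measurable_pi_apply v).comp (hiid.measurable [])
  have hF (u : List V) : Measurable fun ω =>
      if 0 < β [] ω v then positionCdf P β u (t + Real.log (β [] ω v)) else 0 :=
    Measurable.ite (measurableSet_lt measurable_const hb)
      ((monotone_positionCdf u).measurable.comp (hb.log.const_add t)) measurable_const
  simp_rw [hiid.positionCdf_cons, hc, ← lintegral_const_mul _ (hF _)]
  rw [← lintegral_tsum fun u => ((hF u).const_mul _).aemeasurable]
  refine lintegral_congr fun ω => ?_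
  split_ifs
  · rfl
  · simp

lemma IsIID.expectedCount_eq (hiid : IsIID P β) (t : ℝ) :
    expectedCount P β t = weightedCount P β (fun _ => 1) t := by
  have hms (w : List V) : MeasurableSet {ω | (position β ω w : EReal) ≤ (t : EReal)} :=
    (measurableSet_coe_le t).preimage (measurable_position fun u _ => hiid.measurable u)
  have h (ω : Ω) : (count β t ω : ℝ≥0∞)
      = ∑' w, {ω | (position β ω w : EReal) ≤ (t : EReal)}.indicator 1 ω := by
    rw [count, ← ENNReal.tsum_set_one, tsum_subtype _ fun _ => (1 : ℝ≥0∞)]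
    rfl
  simp_rw [expectedCount, h, weightedCount, one_mul]
  rw [lintegral_tsum fun w => (measurable_one.indicator (hms w)).aemeasurable]
  simp_rw [lintegral_indicator_one (hms _), positionCdf]

end Model

/-! ### The size-biased law -/

section Model

variable {V Ω : Type*} [MeasurableSpace Ω] {P : Measure Ω} {β : List V → Ω → V → ℝ}

/-- The size-biased displacement law `A ↦ E[∑ β_v 1{-log β_v ∈ A}]` at the root. -/
noncomputable def tiltedLaw (P : Measure Ω) (β : List V → Ω → V → ℝ) : Measure ℝ :=
  Measure.sum fun v => (P.withDensity fun ω => ENNReal.ofReal (β [] ω v)).map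
    fun ω => -Real.log (β [] ω v)

variable [Fintype V]

lemma IsIID.measurable_root (hiid : IsIID P β) (v : V) : Measurable fun ω => β [] ω v :=
  (measurable_pi_apply v).comp (hiid.measurable [])

lemma IsIID.measurable_neg_log_root (hiid : IsIID P β) (v : V) :
    Measurable fun ω => -Real.log (β [] ω v) :=
  (hiid.measurable_root v).log.neg

lemma IsIID.ae_root (hiid : IsIID P β) :
    ∀ᵐ ω ∂P, (∀ v, 0 ≤ β [] ω v) ∧ (∀ v, β [] ω v ≤ 1) ∧ ∑ v, β [] ω v = 1 := by
  filter_upwards [hiid.mem_simplex []] with ω hω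
  refine ⟨hω.1, fun v => ?_, hω.2⟩
  rw [← hω.2]
  exact Finset.single_le_sum (fun i _ => hω.1 i) (Finset.mem_univ v)

lemma IsIID.lintegral_tiltedLaw (hiid : IsIID P β) {f : ℝ → ℝ≥0∞} (hf : Measurable f) :
    ∫⁻ y, f y ∂tiltedLaw P β
      = ∑ v, ∫⁻ ω, ENNReal.ofReal (β [] ω v) * f (-Real.log (β [] ω v)) ∂P := by
  rw [tiltedLaw, lintegral_sum_measure, tsum_fintype]
  refine Finset.sum_congr rfl fun v _ => ?_
  have hb := hiid.measurable_root v
  have hl := hiid.measurable_neg_log_root v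
  rw [lintegral_map hf hl]
  exact lintegral_withDensity_eq_lintegral_mul _ hb.ennreal_ofReal (hf.comp hl)

lemma IsIID.isProbabilityMeasure_tiltedLaw [IsProbabilityMeasure P] (hiid : IsIID P β) :
    IsProbabilityMeasure (tiltedLaw P β) := by
  constructor
  have h := hiid.lintegral_tiltedLaw (f := fun _ => 1) measurable_const
  simp only [mul_one, lintegral_const, one_mul] at h
  rw [h, ← lintegral_finsetSum _ fun v _ => (hiid.measurable_root v).ennreal_ofReal]
  have h1 : ∫⁻ _, 1 ∂P = 1 := by simp
  refine Eq.trans (lintegral_congr_ae ?_) h1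
  filter_upwards [hiid.ae_root] with ω hω
  rw [← ENNReal.ofReal_sum_of_nonneg fun v _ => hω.1 v, hω.2.2, ENNReal.ofReal_one]

lemma IsIID.ae_nonneg_tiltedLaw (hiid : IsIID P β) : ∀ᵐ y ∂tiltedLaw P β, 0 ≤ y := by
  refine Measure.ae_sum_iff.2 fun v => ?_
  rw [ae_map_iff (hiid.measurable_neg_log_root v).aemeasurable measurableSet_Ici]
  refine (withDensity_absolutelyContinuous P _).ae_le ?_
  filter_upwards [hiid.ae_root] with ω hω
  exact neg_nonneg.2 (Real.log_nonpos (hω.1 v) (hω.2.1 v))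

lemma IsIID.lintegral_id_tiltedLaw (hiid : IsIID P β) (hμ : 0 < meanEntropy P β) :
    ∫⁻ y, ENNReal.ofReal y ∂tiltedLaw P β = ENNReal.ofReal (meanEntropy P β) := by
  -- Positivity of μ rules out the default value 0 of a divergent integral.
  have hi : Integrable (fun ω => -∑ v, β [] ω v * Real.log (β [] ω v)) P := by
    by_contra h
    rw [meanEntropy, integral_undef h] at hμ
    exact hμ.false
  have hb := hiid.measurable_root
  rw [hiid.lintegral_tiltedLaw ENNReal.measurable_ofReal, meanEntropy,
    ofReal_integral_eq_lintegral_ofReal hi,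
    ← lintegral_finsetSum Finset.univ (f := fun v ω =>
      ENNReal.ofReal (β [] ω v) * ENNReal.ofReal (-Real.log (β [] ω v))) fun v _ =>
      (hb v).ennreal_ofReal.mul (hiid.measurable_neg_log_root v).ennreal_ofReal]
  · refine lintegral_congr_ae ?_
    filter_upwards [hiid.ae_root] with ω hω
    rw [← Finset.sum_neg_distrib, ENNReal.ofReal_sum_of_nonneg]
    · refine Finset.sum_congr rfl fun v _ => ?_
      rw [← ENNReal.ofReal_mul (hω.1 v), mul_neg]
    · intro v _
      rw [← mul_neg]
      exact mul_nonneg (hω.1 v) (neg_nonneg.2 (Real.log_nonpos (hω.1 v) (hω.2.1 v)))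
  · filter_upwards [hiid.ae_root] with ω hω
    rw [← Finset.sum_neg_distrib]
    refine Finset.sum_nonneg fun v _ => ?_
    rw [← mul_neg]
    exact mul_nonneg (hω.1 v) (neg_nonneg.2 (Real.log_nonpos (hω.1 v) (hω.2.1 v)))

lemma IsIID.integrable_id_tiltedLaw (hiid : IsIID P β) (hμ : 0 < meanEntropy P β) :
    Integrable (fun y => y) (tiltedLaw P β) := by
  refine ⟨measurable_id.aestronglyMeasurable, ?_⟩
  rw [hasFiniteIntegral_iff_ofReal hiid.ae_nonneg_tiltedLaw, hiid.lintegral_id_tiltedLaw hμ]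
  exact ENNReal.ofReal_lt_top

lemma IsIID.integral_id_tiltedLaw (hiid : IsIID P β) (hμ : 0 < meanEntropy P β) :
    ∫ y, y ∂tiltedLaw P β = meanEntropy P β := by
  rw [integral_eq_lintegral_of_nonneg_ae hiid.ae_nonneg_tiltedLaw
    measurable_id.aestronglyMeasurable, hiid.lintegral_id_tiltedLaw hμ, ENNReal.toReal_ofReal hμ.le]

/-- The density β_v is positive exactly where v contributes a point, so a lattice carrying ρ carries
the point process, with offset 0. -/
lemma IsIID.tiltedLaw_not_lattice (hiid : IsIID P β) (hna : ¬ IsArithmetic P (reproduction β))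
    (c : ℝ) (hc : 0 < c) : ¬ ∀ᵐ y ∂tiltedLaw P β, ∃ n : ℤ, y = c * n := by
  intro h
  refine hna ⟨c, hc, 0, ?_⟩
  have h1 : ∀ v, ∀ᵐ ω ∂P, ENNReal.ofReal (β [] ω v) ≠ 0 →
      ∃ n : ℤ, -Real.log (β [] ω v) = c * n := fun v => by
    have h2 := ae_of_ae_map (hiid.measurable_root v).log.neg.aemeasurable
      (Measure.ae_sum_iff.1 h v)
    rwa [ae_withDensity_iff (hiid.measurable_root v).ennreal_ofReal] at h2
  filter_upwards [ae_all_iff.2 h1] with ω hω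
  rintro x ⟨v, hv, rfl⟩
  obtain ⟨n, hn⟩ := hω v (ENNReal.ofReal_pos.2 hv).ne'
  exact ⟨n, by rw [hn, zero_add]⟩

/-! ### Finiteness of the expected count -/

lemma IsIID.integrable_sum_sq [IsProbabilityMeasure P] (hiid : IsIID P β) :
    Integrable (fun ω => ∑ v, β [] ω v ^ 2) P := by
  refine integrable_finsetSum _ fun v _ => ?_
  refine Integrable.of_bound ((hiid.measurable_root v).pow_const 2).aestronglyMeasurable 1 ?_
  filter_upwards [hiid.ae_root] with ω hω
  rw [Real.norm_eq_abs, abs_of_nonneg (sq_nonneg _)]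
  exact pow_le_one₀ (hω.1 v) (hω.2.1 v)

/-- In case of equality ∑ β_v (1 - β_v) = 0 almost surely, so all weights are 0 or 1 and the entropy
vanishes. -/
lemma IsIID.integral_sum_sq_lt_one [IsProbabilityMeasure P] (hiid : IsIID P β)
    (hμ : 0 < meanEntropy P β) : ∫ ω, ∑ v, β [] ω v ^ 2 ∂P < 1 := by
  have hi : Integrable (fun ω => 1 - ∑ v, β [] ω v ^ 2) P :=
    (integrable_const 1).sub hiid.integrable_sum_sq
  have hsum : ∀ᵐ ω ∂P, 1 - ∑ v, β [] ω v ^ 2 = ∑ v, β [] ω v * (1 - β [] ω v) := by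
    filter_upwards [hiid.ae_root] with ω hω
    rw [← hω.2.2, ← Finset.sum_sub_distrib, hω.2.2]
    exact Finset.sum_congr rfl fun v _ => by ring
  have hnn : 0 ≤ᵐ[P] fun ω => 1 - ∑ v, β [] ω v ^ 2 := by
    filter_upwards [hiid.ae_root, hsum] with ω hω hs
    rw [hs]
    exact Finset.sum_nonneg fun v _ => mul_nonneg (hω.1 v) (by linarith [hω.2.1 v])
  have h1 : ∫ ω, (1 - ∑ v, β [] ω v ^ 2) ∂P = 1 - ∫ ω, ∑ v, β [] ω v ^ 2 ∂P := by
    rw [integral_sub (integrable_const 1) hiid.integrable_sum_sq]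
    simp
  have h2 := integral_nonneg_of_ae hnn
  rw [h1] at h2
  refine lt_of_le_of_ne (by linarith) fun h => hμ.ne' ?_
  rw [h, sub_self] at h1
  rw [integral_eq_zero_iff_of_nonneg_ae hnn hi] at h1
  refine integral_eq_zero_of_ae ?_
  filter_upwards [hiid.ae_root, hsum, h1] with ω hω hs h0
  rw [hs, Pi.zero_apply, Finset.sum_eq_zero_iff_of_nonneg fun v _ =>
    mul_nonneg (hω.1 v) (by linarith [hω.2.1 v])] at h0
  rw [Pi.zero_apply, neg_eq_zero]
  refine Finset.sum_eq_zero fun v hv => ?_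
  rcases mul_eq_zero.1 (h0 v hv) with h | h
  · rw [h, zero_mul]
  · rw [show β [] ω v = 1 by linarith, Real.log_one, mul_zero]

/-- The indicator of the nodes of depth less than `n`. -/
noncomputable def depthLT (V : Type*) (n : ℕ) (w : List V) : ℝ≥0∞ := if w.length < n then 1 else 0

/-- With q = E[∑ β_v²], the function (1 - q)⁻¹ e^{2t} is reproduced by the recursion with source
e^{2t} ≥ 1. Truncation by depth permits induction, as finiteness is not yet known. -/
lemma IsIID.weightedCount_depthLT_le [IsProbabilityMeasure P] (hiid : IsIID P β)
    (hμ : 0 < meanEntropy P β) (n : ℕ) (t : ℝ) :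
    weightedCount P β (depthLT V n) t
      ≤ ENNReal.ofReal ((1 - ∫ ω, ∑ v, β [] ω v ^ 2 ∂P)⁻¹ * Real.exp (2 * t)) := by
  set q := ∫ ω, ∑ v, β [] ω v ^ 2 ∂P with hq
  have hq1 : 0 < 1 - q := sub_pos.2 (hiid.integral_sum_sq_lt_one hμ)
  have hq0 : 0 ≤ q := integral_nonneg fun ω => Finset.sum_nonneg fun v _ => sq_nonneg _
  induction n generalizing t with
  | zero => simp [weightedCount, depthLT]
  | succ n ih =>
    rcases lt_or_ge t 0 with ht | ht
    · rw [weightedCount_of_neg _ ht]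
      exact zero_le
    rw [hiid.weightedCount_eq (depthLT V (n + 1)) (depthLT V n) (fun v u => by simp [depthLT]) ht]
    have hb := hiid.measurable_root
    have h1 : ∑ v, ∫⁻ ω, (if 0 < β [] ω v then
          weightedCount P β (depthLT V n) (t + Real.log (β [] ω v)) else 0) ∂P
        ≤ ∑ v, ∫⁻ ω, ENNReal.ofReal ((1 - q)⁻¹ * Real.exp (2 * t))
            * ENNReal.ofReal (β [] ω v ^ 2) ∂P := by
      refine Finset.sum_le_sum fun v _ => lintegral_mono fun ω => ?_
      dsimp only
      split_ifs with hpos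
      · refine (ih _).trans_eq ?_
        rw [← ENNReal.ofReal_mul (by positivity), mul_assoc, mul_add, Real.exp_add,
          two_mul (Real.log _), Real.exp_add (Real.log _), Real.exp_log hpos, ← sq]
      · exact zero_le
    have h2 : ∑ v, ∫⁻ ω, ENNReal.ofReal ((1 - q)⁻¹ * Real.exp (2 * t))
            * ENNReal.ofReal (β [] ω v ^ 2) ∂P
        = ENNReal.ofReal ((1 - q)⁻¹ * Real.exp (2 * t) * q) := by
      rw [ENNReal.ofReal_mul (q := q) (by positivity), hq,
        ofReal_integral_eq_lintegral_ofReal hiid.integrable_sum_sq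
          (Eventually.of_forall fun ω => Finset.sum_nonneg fun v _ => sq_nonneg _)]
      simp_rw [ENNReal.ofReal_sum_of_nonneg fun v _ => sq_nonneg (β [] _ v)]
      rw [lintegral_finsetSum _ fun v _ => ((hb v).pow_const 2).ennreal_ofReal, Finset.mul_sum]
      exact Finset.sum_congr rfl fun v _ =>
        lintegral_const_mul _ ((hb v).pow_const 2).ennreal_ofReal
    have h3 : depthLT V (n + 1) [] = ENNReal.ofReal 1 := by simp [depthLT]
    refine (add_le_add le_rfl (h1.trans_eq h2)).trans ?_
    rw [h3, ← ENNReal.ofReal_add zero_le_one (by positivity)]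
    refine ENNReal.ofReal_le_ofReal ?_
    have h4 : 1 ≤ Real.exp (2 * t) := Real.one_le_exp (by linarith)
    have h5 : (1 - q)⁻¹ * Real.exp (2 * t)
        = Real.exp (2 * t) + (1 - q)⁻¹ * Real.exp (2 * t) * q := by
      field_simp
      ring
    linarith

lemma IsIID.expectedCount_lt_top [IsProbabilityMeasure P] (hiid : IsIID P β)
    (hμ : 0 < meanEntropy P β) (t : ℝ) : expectedCount P β t < ⊤ := by
  rw [hiid.expectedCount_eq, weightedCount, ENNReal.tsum_eq_iSup_sum]
  refine lt_of_le_of_lt (b := ENNReal.ofReal _) (iSup_le fun s => le_trans ?_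
    (hiid.weightedCount_depthLT_le hμ (s.sup List.length + 1) t)) ENNReal.ofReal_lt_top
  refine le_trans (Finset.sum_le_sum fun w hw => ?_) (ENNReal.sum_le_tsum s)
  rw [depthLT, if_pos (Nat.lt_succ_of_le (Finset.le_sup hw))]

/-! ### Renewal equation for the expected count, and conclusion -/

lemma IsIID.expectedCount_renewal [IsProbabilityMeasure P] (hiid : IsIID P β)
    (hμ : 0 < meanEntropy P β) {t : ℝ} (ht : 0 ≤ t) :
    Real.exp (-t) * (expectedCount P β t).toReal = Real.exp (-t)
      + ∫ y, Real.exp (-(t - y)) * (expectedCount P β (t - y)).toReal ∂tiltedLaw P β := by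
  have hfin := hiid.expectedCount_lt_top hμ
  have hmono : Monotone (expectedCount P β) := by
    rw [funext hiid.expectedCount_eq]
    exact monotone_weightedCount _
  have hm : Measurable (expectedCount P β) := hmono.measurable
  have hb := hiid.measurable_root
  have hZ : Measurable fun y => Real.exp (-(t - y)) * (expectedCount P β (t - y)).toReal := by
    have : Measurable fun y => expectedCount P β (t - y) := hm.comp (measurable_const_sub t)
    have h2 := this.ennreal_toReal
    fun_prop
  have h1 : expectedCount P β t = 1 + ∑ v, ∫⁻ ω,
      (if 0 < β [] ω v then expectedCount P β (t + Real.log (β [] ω v)) else 0) ∂P := by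
    simp_rw [hiid.expectedCount_eq]
    exact hiid.weightedCount_eq _ _ (fun _ _ => rfl) ht
  have h2 : ∫ y, Real.exp (-(t - y)) * (expectedCount P β (t - y)).toReal ∂tiltedLaw P β
      = Real.exp (-t) * (∑ v, ∫⁻ ω,
        (if 0 < β [] ω v then expectedCount P β (t + Real.log (β [] ω v)) else 0) ∂P).toReal := by
    rw [integral_eq_lintegral_of_nonneg_ae
      (Eventually.of_forall fun y => mul_nonneg (Real.exp_pos _).le ENNReal.toReal_nonneg)
      hZ.aestronglyMeasurable, hiid.lintegral_tiltedLaw hZ.ennreal_ofReal,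
      ← ENNReal.toReal_ofReal (Real.exp_pos (-t)).le, ← ENNReal.toReal_mul, Finset.mul_sum]
    congr 1
    refine Finset.sum_congr rfl fun v _ => ?_
    rw [← lintegral_const_mul' _ _ ENNReal.ofReal_ne_top]
    refine lintegral_congr fun ω => ?_
    split_ifs with hpos
    -- The size-biasing factor β_v cancels the β_v⁻¹ contained in e^{-(t + log β_v)}.
    · rw [ENNReal.ofReal_mul (Real.exp_pos _).le, ENNReal.ofReal_toReal (hfin _).ne, ← mul_assoc,
        ← ENNReal.ofReal_mul hpos.le, sub_neg_eq_add, neg_add, Real.exp_add, Real.exp_neg (Real.log _),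
        Real.exp_log hpos]
      congr 2
      field_simp
    · rw [ENNReal.ofReal_of_nonpos (not_lt.1 hpos), zero_mul, mul_zero]
  have h3 : ∑ v, ∫⁻ ω, (if 0 < β [] ω v then
      expectedCount P β (t + Real.log (β [] ω v)) else 0) ∂P ≠ ⊤ := fun h => by
    rw [h] at h1
    exact (hfin t).ne (by simp [h1])
  rw [h2, h1, ENNReal.toReal_add ENNReal.one_ne_top h3, ENNReal.toReal_one]
  ring

end Model

end TokenTree

theorem mainTheorem7 {V Ω : Type*} [Fintype V] [MeasurableSpace Ω]
    (P : Measure Ω) [IsProbabilityMeasure P] (β : List V → Ω → V → ℝ)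
    (hiid : TokenTree.IsIID P β)
    (hμ : 0 < TokenTree.meanEntropy P β)
    (hμ₂ : TokenTree.secondLogMoment P β < ⊤)
    (hna : ¬ TokenTree.IsArithmetic P (TokenTree.reproduction β)) :
    (∀ t : ℝ, TokenTree.expectedCount P β t < ⊤) ∧
      (fun t : ℝ => (TokenTree.expectedCount P β t).toReal
          - Real.exp t / TokenTree.meanEntropy P β) =o[atTop] (fun t : ℝ => Real.exp t) := by
  have hfin := hiid.expectedCount_lt_top hμ
  refine ⟨hfin, ?_⟩
  have : IsProbabilityMeasure (TokenTree.tiltedLaw P β) := hiid.isProbabilityMeasure_tiltedLaw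
  have h := TokenTree.tendsto_exp_neg_mul_of_renewal (ρ := TokenTree.tiltedLaw P β)
    (M := fun t => (TokenTree.expectedCount P β t).toReal)
    (fun s t hst => ENNReal.toReal_mono (hfin t).ne (by
      rw [hiid.expectedCount_eq, hiid.expectedCount_eq]
      exact TokenTree.monotone_weightedCount _ hst))
    (fun t ht => by rw [hiid.expectedCount_eq, TokenTree.weightedCount_of_neg _ ht,
      ENNReal.toReal_zero])
    hiid.ae_nonneg_tiltedLaw (hiid.integrable_id_tiltedLaw hμ)
    (by rwa [hiid.integral_id_tiltedLaw hμ]) (fun c hc => hiid.tiltedLaw_not_lattice hna c hc)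
    (fun t ht => hiid.expectedCount_renewal hμ ht)
  rw [hiid.integral_id_tiltedLaw hμ] at h
  rw [Asymptotics.isLittleO_iff_tendsto fun t ht => absurd ht (Real.exp_pos t).ne']
  have h2 := h.sub_const (1 / TokenTree.meanEntropy P β)
  rw [sub_self] at h2
  refine h2.congr fun t => ?_
  rw [Real.exp_neg]
  field_simp
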